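/- All rings are associative and unital, not necessarily commutative. Let $R$ be a ring, let $M$ be an $(R,R)$-bimodule, and let $R\propto M$ be the trivial extension: the additive group $R\oplus M$ with the multiplication $(r,m)(s,n)=(rs,\,rn+ms)$. Call an element $a$ of a ring $S$ left quasi-morphic if there are $b,c\in S$ with $\mathrm{ann}_l(a)=Sb$ and $\mathrm{ann}_l(c)=Sa$, and right quasi-morphic if there are $b,c\in S$ with $\mathrm{ann}_r(a)=bS$ and $\mathrm{ann}_r(c)=aS$; the ring $S$ is quasi-morphic if each of its elements is both left and right quasi-morphic. The ring $R$ is left perfect if $R/J(R)$ is semisimple and the Jacobson radical $J(R)$ is left $T$-nilpotent, that is, for every sequence $a_1,a_2,\dots$ in $J(R)$ there is $n\ge 1$ with $a_1a_2\cdots a_n=0$. An artinian principal ring is a ring that is left and right artinian and in which every left ideal and every right ideal is principal. **Theorem.** Suppose that $R$ is left perfect and that $R\propto M$ is quasi-morphic. Then: 1. $R$ is an artinian principal ring; 2. $R\propto M$ is an artinian principal ring; 3. there are a two-sided ideal $I$ of $R$ and a ring automorphism $\sigma$ of $\overline{R}=R/I$ such that $M\cong\overline{R}(\sigma)$ as $(R,R)$-bimodules.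 Here $\overline{R}(\sigma)$ is $\overline{R}$ with its usual left multiplication and the right multiplication $s\cdot t=s\,\sigma(t)$ for $s\in\overline R(\sigma)$, $t\in\overline{R}$, viewed as an $(R,R)$-bimodule through the quotient map $R\to\overline{R}$. -/

import Mathlib

/-- The element `a` is left quasi-morphic: there are `b`, `c` with `ann_l(a) = R b` and
`ann_l(c) = R a`. -/
def IsLeftQuasiMorphicElem {R : Type*} [Ring R] (a : R) : Prop :=
  ∃ b c : R, {x : R | x * a = 0} = {x : R | ∃ r : R, x = r * b} ∧
    {x : R | x * c = 0} = {x : R | ∃ r : R, x = r * a}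

/-- The element `a` is right quasi-morphic: there are `b`, `c` with `ann_r(a) = b R` and
`ann_r(c) = a R`. -/
def IsRightQuasiMorphicElem {R : Type*} [Ring R] (a : R) : Prop :=
  ∃ b c : R, {x : R | a * x = 0} = {x : R | ∃ r : R, x = b * r} ∧
    {x : R | c * x = 0} = {x : R | ∃ r : R, x = a * r}

/-- A ring is quasi-morphic if each of its elements is both left and right quasi-morphic. -/
structure IsQuasiMorphicRing (R : Type*) [Ring R] : Prop where
  left : ∀ a : R, IsLeftQuasiMorphicElem a
  right : ∀ a : R, IsRightQuasiMorphicElem a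

/-- The product `a 0 * a 1 * ⋯ * a (n - 1)`, in this order. -/
def initialProd {R : Type*} [Ring R] (a : ℕ → R) (n : ℕ) : R :=
  (List.ofFn fun i : Fin n => a i).prod

/-- A subset `S` is left T-nilpotent if for every sequence `a 0, a 1, …` in `S` some initial
product `a 0 * a 1 * ⋯ * a (n - 1)` with `n ≥ 1` vanishes. -/
def IsLeftTNilpotent {R : Type*} [Ring R] (S : Set R) : Prop :=
  ∀ a : ℕ → R, (∀ i, a i ∈ S) → ∃ n : ℕ, 1 ≤ n ∧ initialProd a n = 0

/-- A ring is left perfect if it is semisimple modulo its Jacobson radical and the Jacobson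
radical is left T-nilpotent. -/
structure IsLeftPerfectRing (R : Type*) [Ring R] : Prop where
  semisimple : IsSemisimpleRing (R ⧸ Ring.jacobson R)
  tNilpotent : IsLeftTNilpotent (Ring.jacobson R : Set R)

/-- A (two-sided) artinian ring all of whose left ideals and all of whose right ideals are
principal. Right ideals are left ideals of the opposite ring. -/
structure IsArtinianPrincipalRing (R : Type*) [Ring R] : Prop where
  left_artinian : IsArtinianRing R
  right_artinian : IsArtinianRing Rᵐᵒᵖ
  left_principal : IsPrincipalIdealRing R
  right_principal : IsPrincipalIdealRing Rᵐᵒᵖ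

/-- The `(A, A)`-bimodule `A(σ)` of a ring endomorphism `σ` of `A`: the left module `A` with the
right multiplication `s · a = s * σ a`. -/
def TwistedBimodule {A : Type*} [Ring A] (_σ : A →+* A) : Type _ := A

namespace TwistedBimodule

variable {A : Type*} [Ring A] (σ : A →+* A)

instance : AddCommGroup (TwistedBimodule σ) := inferInstanceAs (AddCommGroup A)

instance : Module A (TwistedBimodule σ) := inferInstanceAs (Module A A)

instance : Module Aᵐᵒᵖ (TwistedBimodule σ) := Module.compHom A (RingHom.op σ)

/-- An element of `A`, seen in `A(σ)`. -/
def of (s : A) : TwistedBimodule σ := s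

theorem smul_of (a s : A) : a • of σ s = of σ (a * s) := rfl

theorem op_smul_of (a s : A) : MulOpposite.op a • of σ s = of σ (s * σ a) := rfl

instance : SMulCommClass A Aᵐᵒᵖ (TwistedBimodule σ) where
  smul_comm a b s := (mul_assoc (a : A) (s : A) (σ b.unop)).symm

end TwistedBimodule

/-- An `(A, A)`-bimodule `N`, viewed as an `(R, R)`-bimodule along a ring homomorphism
`f : R → A`. -/
def RestrictBimodule {R A : Type*} [Ring R] [Ring A] (_f : R →+* A) (N : Type*) : Type _ := N

namespace RestrictBimodule

variable {R A : Type*} [Ring R] [Ring A] (f : R →+* A) (N : Type*) [AddCommGroup N]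

instance : AddCommGroup (RestrictBimodule f N) := inferInstanceAs (AddCommGroup N)

instance [Module A N] : Module R (RestrictBimodule f N) := Module.compHom N f

instance [Module Aᵐᵒᵖ N] : Module Rᵐᵒᵖ (RestrictBimodule f N) := Module.compHom N (RingHom.op f)

variable {N}

/-- An element of `N`, seen in the restricted bimodule. -/
def of (n : N) : RestrictBimodule f N := n

theorem smul_of [Module A N] (r : R) (n : N) : r • of f n = of f (f r • n) := rfl

theorem op_smul_of [Module Aᵐᵒᵖ N] (r : R) (n : N) :
    MulOpposite.op r • of f n = of f (MulOpposite.op (f r) • n) := rfl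

instance [Module A N] [Module Aᵐᵒᵖ N] [SMulCommClass A Aᵐᵒᵖ N] :
    SMulCommClass R Rᵐᵒᵖ (RestrictBimodule f N) where
  smul_comm r s n := smul_comm (f r) (MulOpposite.op (f s.unop)) (show N from n)

end RestrictBimodule

/-- Isomorphisms of `(R, R)`-bimodules: additive bijections which are left and right linear. -/
structure BimoduleEquiv (R M N : Type*) [Ring R]
    [AddCommGroup M] [Module R M] [Module Rᵐᵒᵖ M] [SMulCommClass R Rᵐᵒᵖ M]
    [AddCommGroup N] [Module R N] [Module Rᵐᵒᵖ N] [SMulCommClass R Rᵐᵒᵖ N]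
    extends M ≃+ N where
  map_smul' : ∀ (r : R) (m : M), toFun (r • m) = r • toFun m
  map_op_smul' : ∀ (r : R) (m : M),
    toFun (MulOpposite.op r • m) = MulOpposite.op r • toFun m

/-! Write S = R ∝ M. Since 0 ⊕ M squares to zero, S is again left perfect. Quasi-morphicity makes
finitely generated left ideals of S principal. T-nilpotent Nakayama, with the bounded length of
cyclic modules over S/J, extends this to all left ideals. Then S is left noetherian, J is nilpotent
and S is left artinian. Double annihilators carry both properties to right ideals, so S is an
artinian principal ring, and so is its quotient R.

The ideal 0 ⊕ M is now generated on both sides by one normal element (0, m), so M = Rm = mR. The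
rule mt = σ(t)m defines an automorphism modulo the annihilator of m once the left and right
annihilators of m agree.

This agreement (`IsNormalElem.mul_eq_zero_comm`) is the main point. If one annihilator of a normal
element contains the other, they are equal, because a surjective endomorphism of a noetherian ring
is injective (`Subring.mk_zero_mem_of_surjective`). In general a central idempotent splits the
element into two normal pieces, one for each inclusion. It comes from a comaximality statement for
two-sided ideals (`exists_mul_mem_and_mul_one_sub_mem`) and Fitting's lemma. -/

theorem Ideal.mem_span_singleton_left {S : Type*} [Ring S] {a x : S} :
    x ∈ Ideal.span {a} ↔ ∃ r, x = r * a := by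
  rw [Ideal.mem_span_singleton']
  simp [eq_comm]

/-! ### Finitely generated left ideals of quasi-morphic rings -/

/-- In a left quasi-morphic ring, the sum of two principal left ideals is principal. -/
theorem exists_span_sup_span_eq_span {S : Type*} [Ring S]
    (hS : ∀ a : S, IsLeftQuasiMorphicElem a) (a b : S) :
    ∃ d : S, Ideal.span {a} ⊔ Ideal.span {b} = Ideal.span {d} := by
  -- With Sa = ann_l(c), Sbc = ann_l(d) and ann_l(cd) = Se: xcd = 0 iff xc = rbc for some r, iff x -
  -- rb ∈ Sa.
  obtain ⟨-, c, -, hc⟩ := hS a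
  obtain ⟨-, d, -, hd⟩ := hS (b * c)
  obtain ⟨e, -, he, -⟩ := hS (c * d)
  refine ⟨e, Ideal.ext fun x => ?_⟩
  simp only [Set.ext_iff, Set.mem_ofPred_eq] at hc hd he
  rw [Ideal.mem_span_singleton_left, ← he, ← mul_assoc, hd, Submodule.mem_sup]
  constructor
  · rintro ⟨y, hy, z, hz, rfl⟩
    rw [Ideal.mem_span_singleton_left] at hy hz
    obtain ⟨r, rfl⟩ := hz
    exact ⟨r, by rw [add_mul, (hc y).2 hy, zero_add, mul_assoc]⟩
  · rintro ⟨r, hr⟩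
    refine ⟨x - r * b, Ideal.mem_span_singleton_left.2 ((hc _).1 ?_), r * b,
      Ideal.mem_span_singleton_left.2 ⟨r, rfl⟩, sub_add_cancel _ _⟩
    rw [sub_mul, hr, mul_assoc, sub_self]

theorem isPrincipal_of_fg_of_isLeftQuasiMorphicElem {S : Type*} [Ring S]
    (hS : ∀ a : S, IsLeftQuasiMorphicElem a) (N : Ideal S) (hN : N.FG) : N.IsPrincipal := by
  induction N, hN using Submodule.fg_induction with
  | singleton x => exact ⟨x, rfl⟩
  | sup N₁ N₂ _ _ h₁ h₂ =>
    obtain ⟨a, rfl⟩ := h₁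
    obtain ⟨b, rfl⟩ := h₂
    obtain ⟨d, hd⟩ := exists_span_sup_span_eq_span hS a b
    exact ⟨d, hd⟩

/-! ### Left T-nilpotence and left perfect rings -/

theorem initialProd_zero {S : Type*} [Ring S] (a : ℕ → S) : initialProd a 0 = 1 := by
  simp [initialProd]

theorem initialProd_succ {S : Type*} [Ring S] (a : ℕ → S) (n : ℕ) :
    initialProd a (n + 1) = initialProd a n * a n := by
  rw [initialProd, List.ofFn_succ_last]
  simp [initialProd]

theorem initialProd_add {S : Type*} [Ring S] (a : ℕ → S) (n k : ℕ) :
    initialProd a (n + k) = initialProd a n * initialProd (fun i => a (n + i)) k := by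
  induction k with
  | zero => simp [initialProd_zero]
  | succ k ih => rw [← add_assoc, initialProd_succ, ih, initialProd_succ, mul_assoc]

theorem initialProd_const {S : Type*} [Ring S] (a : S) (n : ℕ) :
    initialProd (fun _ => a) n = a ^ n := by
  induction n with
  | zero => simp [initialProd_zero]
  | succ n ih => rw [initialProd_succ, ih, pow_succ]

theorem map_initialProd {S T : Type*} [Ring S] [Ring T] (f : S →+* T) (a : ℕ → S) (n : ℕ) :
    f (initialProd a n) = initialProd (fun i => f (a i)) n := by
  induction n with
  | zero => simp [initialProd_zero]
  | succ n ih => rw [initialProd_succ, map_mul, ih, initialProd_succ]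

/-- A property of `1` which is always preserved by right multiplication by some element of a
left T-nilpotent set holds for `0`. -/
theorem IsLeftTNilpotent.zero_of_one {S : Type*} [Ring S] {X : Set S} (hX : IsLeftTNilpotent X)
    {P : S → Prop} (h1 : P 1) (h : ∀ p, P p → ∃ x ∈ X, P (p * x)) : P 0 := by
  choose! g hgX hgP using h
  let p : ℕ → S := fun n => Nat.rec 1 (fun _ q => q * g q) n
  have hp : ∀ n, P (p n) := fun n => by
    induction n with
    | zero => exact h1
    | succ n ih => exact hgP _ ih
  have hprod : ∀ n, initialProd (fun i => g (p i)) n = p n := fun n => by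
    induction n with
    | zero => exact initialProd_zero _
    | succ n ih => rw [initialProd_succ, ih]
  obtain ⟨n, -, hn⟩ := hX (fun i => g (p i)) fun i => hgX _ (hp i)
  rw [← hn, hprod]
  exact hp n

/-- Nakayama's lemma for left T-nilpotent ideals, without a finiteness condition. -/
theorem Ideal.le_of_le_sup_smul_of_isLeftTNilpotent {S : Type*} [Ring S] {J : Ideal S}
    (hJ : IsLeftTNilpotent (J : Set S)) {X N : Ideal S} (h : N ≤ X ⊔ J • N) : N ≤ X := by
  by_contra hN
  rw [SetLike.not_le_iff_exists] at hN
  have key : ∃ n ∈ N, (0 : S) * n ∉ X := by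
    refine hJ.zero_of_one (P := fun p => ∃ n ∈ N, p * n ∉ X) (by simpa using hN) ?_
    rintro p ⟨n, hn, hpn⟩
    by_contra! hcon
    apply hpn
    have hJN : ∀ y ∈ J • N, p * y ∈ X := fun y hy => by
      refine Submodule.smul_induction_on hy (fun j hj m hm => ?_) fun y z hy hz => ?_
      · rw [smul_eq_mul, ← mul_assoc]
        exact hcon j hj m hm
      · rw [mul_add]
        exact X.add_mem hy hz
    obtain ⟨x, hx, y, hy, rfl⟩ := Submodule.mem_sup.1 (h hn)
    rw [mul_add]
    exact X.add_mem (X.mul_mem_left _ hx) (hJN y hy)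
  obtain ⟨n, -, hn⟩ := key
  exact hn (by simp)

theorem Ideal.length_quotient_ne_top {S : Type*} [Ring S] (J : Ideal S) [J.IsTwoSided]
    [IsSemisimpleRing (S ⧸ J)] : Module.length S (S ⧸ J) ≠ ⊤ := by
  let e : S ⧸ J →ₛₗ[Ideal.Quotient.mk J] S ⧸ J := ⟨.id _, fun _ _ => rfl⟩
  have h₁ : IsNoetherian S (S ⧸ J) :=
    (e.isNoetherian_iff_of_bijective Function.bijective_id).2 inferInstance
  have h₂ : IsArtinian S (S ⧸ J) :=
    (e.isArtinian_iff_of_bijective Function.bijective_id).2 inferInstance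
  exact Module.length_ne_top

theorem Submodule.eq_of_le_of_length_le {S Q : Type*} [Ring S] [AddCommGroup Q] [Module S Q]
    {A B : Submodule S Q} (hAB : A ≤ B) (hB : Module.length S B ≠ ⊤)
    (h : Module.length S B ≤ Module.length S A) : A = B := by
  rw [Module.length_ne_top_iff, isFiniteLength_iff_isNoetherian_isArtinian] at hB
  obtain ⟨_, _⟩ := hB
  by_contra hne
  have hlt := Submodule.length_lt (N := A.submoduleOf B)
    (fun htop => hne (le_antisymm hAB (Submodule.submoduleOf_eq_top.1 htop)))
  rw [(Submodule.submoduleOfEquivOfLe hAB).length_eq] at hlt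
  exact absurd h hlt.not_ge

/-- A left perfect ring all of whose finitely generated left ideals are principal is a principal
left ideal ring. -/
theorem IsLeftPerfectRing.isPrincipalIdealRing {S : Type*} [Ring S] (hS : IsLeftPerfectRing S)
    (hfg : ∀ N : Ideal S, N.FG → N.IsPrincipal) : IsPrincipalIdealRing S := by
  refine ⟨fun N => ?_⟩
  have := hS.semisimple
  set J := Ring.jacobson S
  let q := (J • N : Ideal S).mkQ
  -- `J` kills `q x`, so the cyclic module it spans is a quotient of S/J.
  have hbound : ∀ x ∈ N, Module.length S (Submodule.span S {q x}) ≤ Module.length S (S ⧸ J) := by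
    intro x hx
    have hle : J ≤ LinearMap.ker (LinearMap.toSpanSingleton S _ (q x)) := fun j hj => by
      rw [LinearMap.mem_ker, LinearMap.toSpanSingleton_apply, ← map_smul]
      exact (Submodule.Quotient.mk_eq_zero _).2 (Submodule.smul_mem_smul hj hx)
    rw [LinearMap.span_singleton_eq_range, ← Submodule.range_liftQ J _ hle]
    exact Module.length_le_of_surjective _ (LinearMap.surjective_rangeRestrict _)
  have hfin : ∀ x ∈ N, Module.length S (Submodule.span S {q x}) ≠ ⊤ := fun x hx =>
    ne_top_of_le_ne_top J.length_quotient_ne_top (hbound x hx)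
  let V : Set ℕ := {n | ∃ x ∈ N, Module.length S (Submodule.span S {q x}) = n}
  have hVne : V.Nonempty := by
    obtain ⟨n, hn⟩ := ENat.ne_top_iff_exists.1 (hfin 0 N.zero_mem)
    exact ⟨n, 0, N.zero_mem, hn.symm⟩
  obtain ⟨ℓ, hℓ⟩ := ENat.ne_top_iff_exists.1 J.length_quotient_ne_top
  have hVbdd : BddAbove V := by
    refine ⟨ℓ, ?_⟩
    rintro n ⟨x, hx, hn⟩
    have := hbound x hx
    rw [hn, ← hℓ] at this
    exact_mod_cast this
  -- Choose x with image of maximal length. If Sx + Sy = Sd, then d cannot have a longer image, so x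
  -- already generates the image of y.
  obtain ⟨x, hx, hxV⟩ := Nat.sSup_mem hVne hVbdd
  have hmax : ∀ y ∈ N, y ∈ Ideal.span {x} ⊔ J • N := by
    intro y hy
    obtain ⟨d, hd⟩ := hfg (Ideal.span {x, y}) (Submodule.fg_span (Set.toFinite _))
    have hxd : x ∈ Submodule.span S {d} := hd ▸ Ideal.subset_span (by simp)
    have hyd : y ∈ Submodule.span S {d} := hd ▸ Ideal.subset_span (by simp)
    have hdN : d ∈ N := by
      have : Ideal.span {x, y} ≤ N := Ideal.span_le.2 (by simp [Set.insert_subset_iff, hx, hy])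
      exact this (hd ▸ Submodule.mem_span_singleton_self d)
    have hqspan : ∀ z ∈ Submodule.span S {d}, q z ∈ Submodule.span S {q d} := fun z hz => by
      obtain ⟨r, rfl⟩ := Submodule.mem_span_singleton.1 hz
      exact Submodule.mem_span_singleton.2 ⟨r, (map_smul q r d).symm⟩
    have heq : Submodule.span S {q x} = Submodule.span S {q d} := by
      refine Submodule.eq_of_le_of_length_le ?_ (hfin d hdN) ?_
      · rw [Submodule.span_singleton_le_iff_mem]
        exact hqspan x hxd
      · obtain ⟨n, hn⟩ := ENat.ne_top_iff_exists.1 (hfin d hdN)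
        rw [hxV, ← hn]
        exact_mod_cast le_csSup hVbdd ⟨d, hdN, hn.symm⟩
    obtain ⟨r, hr⟩ := Submodule.mem_span_singleton.1 (heq ▸ hqspan y hyd)
    rw [← map_smul, eq_comm] at hr
    have hmem := (Submodule.Quotient.eq _).1 hr
    exact Submodule.mem_sup.2 ⟨r • x, Submodule.smul_mem _ _ (Ideal.mem_span_singleton_self x),
      _, hmem, by abel⟩
  refine ⟨x, le_antisymm (Ideal.le_of_le_sup_smul_of_isLeftTNilpotent hS.tNilpotent hmax) ?_⟩
  rwa [Submodule.span_singleton_le_iff_mem]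

/-- The left annihilator of a subset. -/
def leftAnnihilator {S : Type*} [Ring S] (X : Set S) : Ideal S where
  carrier := {s | ∀ x ∈ X, s * x = 0}
  add_mem' h₁ h₂ x hx := by rw [add_mul, h₁ x hx, h₂ x hx, add_zero]
  zero_mem' x _ := zero_mul x
  smul_mem' r s h x hx := by rw [smul_eq_mul, mul_assoc, h x hx, mul_zero]

/-- The left annihilators of the powers of J stabilise at some n. If J ^ n ≠ 0, an element p not
annihilating J ^ n does not annihilate J ^ (n + 1) either, so some pj with j in J does not
annihilate J ^ n. Iterating from 1 contradicts T-nilpotence. -/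
theorem IsLeftPerfectRing.isNilpotent_jacobson {S : Type*} [Ring S] [IsNoetherianRing S]
    (hS : IsLeftPerfectRing S) : IsNilpotent (Ring.jacobson S) := by
  set J := Ring.jacobson S
  obtain ⟨n, hn⟩ := monotone_stabilizes_iff_noetherian.2 ‹IsNoetherianRing S›
    ⟨fun k => leftAnnihilator (J ^ k : Ideal S), fun k l hkl s hs x hx =>
      hs x (Ideal.pow_le_pow_right hkl hx)⟩
  have hn' : leftAnnihilator ((J ^ n : Ideal S) : Set S) = leftAnnihilator (J ^ (n + 1) : Ideal S) :=
    hn (n + 1) n.le_succ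
  refine ⟨n, ?_⟩
  by_contra hne
  have h1 : (1 : S) ∉ leftAnnihilator ((J ^ n : Ideal S) : Set S) := fun h =>
    hne ((Submodule.eq_bot_iff _).2 fun x hx => by simpa using h x hx)
  refine hS.tNilpotent.zero_of_one (P := fun p => p ∉ leftAnnihilator ((J ^ n : Ideal S) : Set S))
    h1 (fun p hp => ?_) (zero_mem _)
  by_contra! hcon
  rw [hn'] at hp
  refine hp fun x hx => ?_
  rw [SetLike.mem_coe, Ideal.IsTwoSided.pow_succ, ← smul_eq_mul] at hx
  refine Submodule.smul_induction_on hx (fun j hj m hm => ?_) fun y z hy hz => ?_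
  · rw [smul_eq_mul, ← mul_assoc]
    exact hcon j hj m hm
  · rw [mul_add, hy, hz, add_zero]

theorem IsLeftPerfectRing.isArtinianRing {S : Type*} [Ring S] [IsNoetherianRing S]
    (hS : IsLeftPerfectRing S) : IsArtinianRing S := by
  have : IsSemiprimaryRing S := ⟨hS.semisimple, hS.isNilpotent_jacobson⟩
  exact IsSemiprimaryRing.isNoetherian_iff_isArtinian.1 ‹IsNoetherianRing S›

/-! ### Transfer to right ideals by annihilators -/

theorem IsQuasiMorphicRing.mulOpposite {S : Type*} [Ring S] (hS : IsQuasiMorphicRing S) :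
    IsQuasiMorphicRing Sᵐᵒᵖ := by
  refine ⟨fun a => ?_, fun a => ?_⟩
  · obtain ⟨b, c, hb, hc⟩ := hS.right a.unop
    simp only [Set.ext_iff, Set.mem_ofPred_eq] at hb hc
    refine ⟨.op b, .op c, Set.ext fun x => ?_, Set.ext fun x => ?_⟩
    · simpa [← MulOpposite.unop_inj, MulOpposite.exists] using hb x.unop
    · simpa [← MulOpposite.unop_inj, MulOpposite.exists] using hc x.unop
  · obtain ⟨b, c, hb, hc⟩ := hS.left a.unop
    simp only [Set.ext_iff, Set.mem_ofPred_eq] at hb hc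
    refine ⟨.op b, .op c, Set.ext fun x => ?_, Set.ext fun x => ?_⟩
    · simpa [← MulOpposite.unop_inj, MulOpposite.exists] using hb x.unop
    · simpa [← MulOpposite.unop_inj, MulOpposite.exists] using hc x.unop

/-- In a right quasi-morphic ring, principal right ideals are determined by their left
annihilators. -/
theorem IsRightQuasiMorphicElem.exists_eq_mul {S : Type*} [Ring S] {a : S}
    (ha : IsRightQuasiMorphicElem a) {x : S} (h : ∀ s, s * a = 0 → s * x = 0) :
    ∃ r, x = a * r := by
  obtain ⟨-, c, -, hc⟩ := ha
  simp only [Set.ext_iff, Set.mem_ofPred_eq] at hc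
  exact (hc x).1 (h c ((hc a).2 ⟨1, (mul_one a).symm⟩))

/-- An element of the right ideal with minimal left annihilator generates it: enlarging aS to aS +
xS = bS leaves the annihilator unchanged, and the annihilator determines a principal right ideal. -/
theorem IsQuasiMorphicRing.isPrincipalIdealRing_mulOpposite {S : Type*} [Ring S]
    [IsArtinianRing S] (hS : IsQuasiMorphicRing S) : IsPrincipalIdealRing Sᵐᵒᵖ := by
  refine ⟨fun N => ?_⟩
  obtain ⟨I, ⟨a, haN, rfl⟩, hmin⟩ := (wellFounded_lt (α := Ideal S)).has_min
    {I | ∃ a ∈ N, I = leftAnnihilator {a.unop}} ⟨_, 0, N.zero_mem, rfl⟩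
  refine ⟨a, le_antisymm (fun x hx => ?_) (by rwa [Submodule.span_singleton_le_iff_mem])⟩
  obtain ⟨b, hb⟩ := exists_span_sup_span_eq_span hS.mulOpposite.left a x
  have hbN : b ∈ N := by
    have : Ideal.span {a} ⊔ Ideal.span {x} ≤ N := sup_le
      (by rwa [Ideal.span_singleton_le_iff_mem]) (by rwa [Ideal.span_singleton_le_iff_mem])
    exact this (hb ▸ Ideal.mem_span_singleton_self b)
  have hab : ∃ r, a = r * b := Ideal.mem_span_singleton_left.1
    (hb ▸ Ideal.mem_sup_left (Ideal.mem_span_singleton_self a))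
  have hxb : ∃ r, x = r * b := Ideal.mem_span_singleton_left.1
    (hb ▸ Ideal.mem_sup_right (Ideal.mem_span_singleton_self x))
  obtain ⟨r, hr⟩ := hab
  obtain ⟨t, ht⟩ := hxb
  have hle : leftAnnihilator {b.unop} ≤ leftAnnihilator {a.unop} := by
    rintro s hs _ rfl
    rw [hr, MulOpposite.unop_mul, ← mul_assoc, hs _ rfl, zero_mul]
  have heq := eq_of_le_of_not_lt hle (hmin _ ⟨b, hbN, rfl⟩)
  obtain ⟨u, hu⟩ := (hS.right a.unop).exists_eq_mul (x := x.unop) fun s hs => by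
    have : s ∈ leftAnnihilator {b.unop} := heq ▸ (by rintro _ rfl; exact hs)
    rw [ht, MulOpposite.unop_mul, ← mul_assoc, this _ rfl, zero_mul]
  exact Submodule.mem_span_singleton.2 ⟨.op u, MulOpposite.unop_injective (by simp [hu])⟩

/-- Taking left annihilators is strictly antitone on right ideals, since these are principal; hence
ACC on the left gives DCC on the right. -/
theorem IsQuasiMorphicRing.isArtinianRing_mulOpposite {S : Type*} [Ring S]
    [IsNoetherianRing S] [IsPrincipalIdealRing Sᵐᵒᵖ] (hS : IsQuasiMorphicRing S) :
    IsArtinianRing Sᵐᵒᵖ := by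
  let f : Ideal Sᵐᵒᵖ → Ideal S := fun N => leftAnnihilator (MulOpposite.op ⁻¹' (N : Set Sᵐᵒᵖ))
  have hle : ∀ N N', f N ≤ f N' → N' ≤ N := by
    intro N N' h x hx
    obtain ⟨a, rfl⟩ := IsPrincipalIdealRing.principal N
    obtain ⟨u, hu⟩ := (hS.right a.unop).exists_eq_mul (x := x.unop) fun s hs => by
      refine h (fun y hy => ?_) x.unop hx
      obtain ⟨r, hr⟩ := Submodule.mem_span_singleton.1 hy
      rw [← MulOpposite.unop_op y, ← hr, smul_eq_mul, MulOpposite.unop_mul, ← mul_assoc, hs,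
        zero_mul]
    exact Submodule.mem_span_singleton.2 ⟨.op u, MulOpposite.unop_injective (by simp [hu])⟩
  have hanti : StrictAnti f := fun N N' h =>
    lt_of_le_not_ge (fun s hs x hx => hs x (h.le hx)) fun h' => h.not_ge (hle _ _ h')
  exact hanti.wellFoundedLT

theorem IsLeftPerfectRing.isArtinianPrincipalRing {S : Type*} [Ring S] (hS : IsLeftPerfectRing S)
    (hqm : IsQuasiMorphicRing S) : IsArtinianPrincipalRing S := by
  have h₁ := hS.isPrincipalIdealRing (isPrincipal_of_fg_of_isLeftQuasiMorphicElem hqm.left)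
  have h₂ := hS.isArtinianRing
  have h₃ := hqm.isPrincipalIdealRing_mulOpposite
  exact ⟨h₂, hqm.isArtinianRing_mulOpposite, h₁, h₃⟩

theorem IsArtinianPrincipalRing.of_surjective {S T : Type*} [Ring S] [Ring T]
    (hS : IsArtinianPrincipalRing S) (f : S →+* T) (hf : Function.Surjective f) :
    IsArtinianPrincipalRing T := by
  obtain ⟨_, _, _, _⟩ := hS
  have hf' : Function.Surjective (RingHom.op f) := fun x => by
    obtain ⟨y, hy⟩ := hf x.unop
    exact ⟨.op y, MulOpposite.unop_injective (by simp [hy])⟩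
  exact ⟨hf.isArtinianRing, hf'.isArtinianRing, .of_surjective f hf, .of_surjective _ hf'⟩

/-! ### Normal elements and two-sided ideals -/

/-- An element `a` is normal if it generates the same left ideal and right ideal: `S a = a S`. -/
def IsNormalElem {S : Type*} [Ring S] (a : S) : Prop :=
  ∀ s : S, (∃ t, a * s = t * a) ∧ ∃ t, s * a = a * t

theorem IsNormalElem.mul {S : Type*} [Ring S] {a b : S} (ha : IsNormalElem a)
    (hb : IsNormalElem b) : IsNormalElem (a * b) := by
  intro s
  obtain ⟨t, ht⟩ := (hb s).1
  obtain ⟨u, hu⟩ := (ha t).1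
  obtain ⟨v, hv⟩ := (ha s).2
  obtain ⟨w, hw⟩ := (hb v).2
  exact ⟨⟨u, by rw [mul_assoc, ht, ← mul_assoc, hu, mul_assoc]⟩,
    ⟨w, by rw [← mul_assoc, hv, mul_assoc, hw, mul_assoc]⟩⟩

theorem IsNormalElem.pow {S : Type*} [Ring S] {a : S} (ha : IsNormalElem a) (n : ℕ) :
    IsNormalElem (a ^ n) := by
  induction n with
  | zero => exact fun s => ⟨⟨s, by simp⟩, ⟨s, by simp⟩⟩
  | succ n ih => rw [pow_succ]; exact ih.mul ha

theorem isNormalElem_of_commute {S : Type*} [Ring S] {a : S} (ha : ∀ s, a * s = s * a) :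
    IsNormalElem a :=
  fun s => ⟨⟨s, ha s⟩, ⟨s, (ha s).symm⟩⟩

theorem exists_generator_of_isTwoSided {S : Type*} [Ring S] [IsPrincipalIdealRing Sᵐᵒᵖ]
    (A : Ideal S) [A.IsTwoSided] : ∃ a ∈ A, ∀ x ∈ A, ∃ r, x = a * r := by
  let N : Ideal Sᵐᵒᵖ :=
    { carrier := MulOpposite.unop ⁻¹' (A : Set S)
      add_mem' := fun h₁ h₂ => A.add_mem h₁ h₂
      zero_mem' := A.zero_mem
      smul_mem' := fun r x hx => A.mul_mem_right r.unop hx }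
  obtain ⟨a, ha⟩ := IsPrincipalIdealRing.principal N
  have haN : a ∈ N := ha ▸ Submodule.mem_span_singleton_self a
  refine ⟨a.unop, haN, fun x hx => ?_⟩
  have hxN : MulOpposite.op x ∈ N := hx
  rw [ha] at hxN
  obtain ⟨r, hr⟩ := Submodule.mem_span_singleton.1 hxN
  exact ⟨r.unop, by rw [← MulOpposite.unop_op x, ← hr]; simp⟩

/-- If an element generates a two-sided ideal `A` as a right ideal modulo `C`, then it also
generates `A` as a left ideal modulo `C`. -/
theorem exists_eq_mul_add_of_generates {S : Type*} [Ring S] [IsPrincipalIdealRing S]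
    {A C : Ideal S} [A.IsTwoSided] [C.IsTwoSided] {a : S} (haA : a ∈ A)
    (ha : ∀ x ∈ A, ∃ r, ∃ c ∈ C, x = a * r + c) :
    ∀ x ∈ A, ∃ r, ∃ c ∈ C, x = r * a + c := by
  obtain ⟨b, hb⟩ := IsPrincipalIdealRing.principal A
  have hbA : b ∈ A := hb ▸ Submodule.mem_span_singleton_self b
  have hbgen : ∀ x ∈ A, ∃ r, x = r * b := fun x hx => by
    rw [hb] at hx
    exact Ideal.mem_span_singleton_left.1 hx
  -- Modulo C, A = Sb = Sat, so right multiplication by t maps A onto itself; the stabilising chain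
  -- of ideals {x | xtⁿ ∈ C} makes it injective modulo C. Now xt ≡ rat gives x ≡ ra.
  obtain ⟨t, c₀, hc₀, hbt⟩ := ha b hbA
  have step : ∀ x ∈ A, ∃ r, ∃ c ∈ C, x = r * a * t + c := fun x hx => by
    obtain ⟨r, rfl⟩ := hbgen x hx
    exact ⟨r, r * c₀, C.mul_mem_left _ hc₀, by rw [hbt]; noncomm_ring⟩
  have hpow : ∀ n, ∀ x ∈ A, ∃ w ∈ A, ∃ c ∈ C, x = w * t ^ n + c := by
    intro n
    induction n with
    | zero => exact fun x hx => ⟨x, hx, 0, C.zero_mem, by simp⟩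
    | succ n ih =>
      intro x hx
      obtain ⟨w, hw, c, hc, rfl⟩ := ih x hx
      obtain ⟨r, d, hd, rfl⟩ := step w hw
      refine ⟨r * a, A.mul_mem_left _ haA, d * t ^ n + c,
        C.add_mem (C.mul_mem_right _ hd) hc, ?_⟩
      rw [pow_succ']
      noncomm_ring
  let I : ℕ → Ideal S := fun n =>
    { carrier := {x | x * t ^ n ∈ C}
      add_mem' := fun {x y} h₁ h₂ => by
        simp only [Set.mem_ofPred_eq] at *
        rw [add_mul]
        exact C.add_mem h₁ h₂
      zero_mem' := by simp
      smul_mem' := fun r x h => by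
        simp only [Set.mem_ofPred_eq, smul_eq_mul] at *
        rw [mul_assoc]
        exact C.mul_mem_left _ h }
  have hI : ∀ {n x}, x ∈ I n ↔ x * t ^ n ∈ C := Iff.rfl
  obtain ⟨n, hn⟩ := monotone_stabilizes_iff_noetherian.2 (inferInstanceAs (IsNoetherianRing S))
    ⟨I, monotone_nat_of_le_succ fun n x hx => by
      rw [hI] at *
      rw [pow_succ, ← mul_assoc]
      exact C.mul_mem_right _ hx⟩
  have hn' : I n = I (n + 1) := hn (n + 1) n.le_succ
  intro x hx
  obtain ⟨r, c, hc, hxt⟩ := step (x * t) (A.mul_mem_right _ hx)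
  have hz : x - r * a ∈ A := A.sub_mem hx (A.mul_mem_left _ haA)
  obtain ⟨w, -, d, hd, hw⟩ := hpow n _ hz
  refine ⟨r, x - r * a, ?_, by abel⟩
  have hwI : w ∈ I (n + 1) := by
    have : w * t ^ (n + 1) = c - d * t := by
      calc w * t ^ (n + 1) = (w * t ^ n + d) * t - d * t := by rw [pow_succ]; noncomm_ring
        _ = c - d * t := by rw [← hw, sub_mul, hxt]; abel
    rw [hI, this]
    exact C.sub_mem hc (C.mul_mem_right _ hd)
  rw [← hn', hI] at hwI
  rw [hw]
  exact C.add_mem hwI hd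

/-- In a ring all of whose one-sided ideals are principal, every two-sided ideal is generated by
a normal element. -/
theorem exists_isNormalElem_generator {S : Type*} [Ring S] [IsPrincipalIdealRing S]
    [IsPrincipalIdealRing Sᵐᵒᵖ] (A : Ideal S) [A.IsTwoSided] :
    ∃ a ∈ A, IsNormalElem a ∧ ∀ x ∈ A, ∃ r, x = r * a := by
  obtain ⟨a, haA, ha⟩ := exists_generator_of_isTwoSided A
  have hleft : ∀ x ∈ A, ∃ r, x = r * a := fun x hx => by
    obtain ⟨r, c, hc, h⟩ := exists_eq_mul_add_of_generates (C := ⊥) haA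
      (fun x hx => (ha x hx).imp fun r hr => ⟨0, rfl, by simpa using hr⟩) x hx
    rw [Ideal.mem_bot] at hc
    exact ⟨r, by simpa [hc] using h⟩
  exact ⟨a, haA, fun s => ⟨hleft _ (A.mul_mem_right _ haA), ha _ (A.mul_mem_left _ haA)⟩, hleft⟩

theorem exists_forall_mul_mem_of_generates {S : Type*} [Ring S] [IsPrincipalIdealRing S]
    {A C : Ideal S} [A.IsTwoSided] [C.IsTwoSided] {a s : S} (haA : a ∈ A)
    (ha : ∀ x ∈ A, ∃ r, ∃ c ∈ C, x = a * r + c) (has : a * s ∈ C) : ∀ x ∈ A, x * s ∈ C := by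
  intro x hx
  obtain ⟨r, c, hc, rfl⟩ := exists_eq_mul_add_of_generates haA ha x hx
  rw [add_mul, mul_assoc]
  exact C.add_mem (C.mul_mem_left _ has) (C.mul_mem_right _ hc)

/-- Let A + B = (a + b)S and a = (a + b)s. Then a(1 - s) = bs lies in A ∩ B. Modulo A ∩ B, a and b
generate A and B as right ideals, hence also as left ideals, so these relations spread to all of A
and B. -/
theorem exists_mul_mem_and_mul_one_sub_mem {S : Type*} [Ring S] [IsPrincipalIdealRing S]
    [IsPrincipalIdealRing Sᵐᵒᵖ] (A B : Ideal S) [A.IsTwoSided] [B.IsTwoSided] :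
    ∃ s, (∀ x ∈ B, x * s ∈ A) ∧ ∀ x ∈ A, x * (1 - s) ∈ B := by
  have hAB : (A ⊔ B).IsTwoSided := ⟨fun {x} r hx => by
    obtain ⟨y, hy, z, hz, rfl⟩ := Submodule.mem_sup.1 hx
    rw [add_mul]
    exact Submodule.add_mem_sup (A.mul_mem_right r hy) (B.mul_mem_right r hz)⟩
  have hC : (A ⊓ B).IsTwoSided := ⟨fun b h => ⟨A.mul_mem_right _ h.1, B.mul_mem_right _ h.2⟩⟩
  obtain ⟨y, hy, hgen⟩ := exists_generator_of_isTwoSided (A ⊔ B)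
  obtain ⟨a, ha, b, hb, rfl⟩ := Submodule.mem_sup.1 hy
  obtain ⟨s, hs⟩ := hgen a (Ideal.mem_sup_left ha)
  have hbs : a * (1 - s) = b * s := by
    calc a * (1 - s) = a - a * s := by noncomm_ring
      _ = (a + b) * s - a * s := by rw [← hs]
      _ = b * s := by noncomm_ring
  have hbsA : b * s ∈ A := hbs ▸ A.mul_mem_right _ ha
  have hasB : a * (1 - s) ∈ B := hbs ▸ B.mul_mem_right _ hb
  refine ⟨s, fun x hx => ?_, fun x hx => ?_⟩
  · refine (exists_forall_mul_mem_of_generates (C := A ⊓ B) hb ?_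
      ⟨hbsA, B.mul_mem_right _ hb⟩ x hx).1
    intro z hz
    obtain ⟨r, hr⟩ := hgen z (Ideal.mem_sup_right hz)
    have har : a * r = z - b * r := by rw [hr]; noncomm_ring
    exact ⟨r, a * r, ⟨A.mul_mem_right _ ha, har ▸ B.sub_mem hz (B.mul_mem_right _ hb)⟩,
      by rw [hr]; noncomm_ring⟩
  · refine (exists_forall_mul_mem_of_generates (C := A ⊓ B) ha ?_
      ⟨A.mul_mem_right _ ha, hasB⟩ x hx).2
    intro z hz
    obtain ⟨r, hr⟩ := hgen z (Ideal.mem_sup_left hz)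
    have hbr : b * r = z - a * r := by rw [hr]; noncomm_ring
    exact ⟨r, b * r, ⟨hbr ▸ A.sub_mem hz (A.mul_mem_right _ ha), B.mul_mem_right _ hb⟩,
      by rw [hr]; noncomm_ring⟩

/-! ### Central idempotents -/

/-- Fitting's lemma for a normal element: some power of it generates the same left ideal as a
central idempotent. -/
theorem IsNormalElem.exists_central_idempotent {S : Type*} [Ring S] [IsArtinianRing S] {u : S}
    (hu : IsNormalElem u) : ∃ n : ℕ, 0 < n ∧ ∃ e p : S, (∀ s, e * s = s * e) ∧ e * e = e ∧
      e = p * u ^ n ∧ e * u ^ n = u ^ n := by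
  obtain ⟨k, hk⟩ := IsArtinian.monotone_stabilizes (R := S) (M := S)
    ⟨fun n => OrderDual.toDual (Ideal.span {u ^ n}), monotone_nat_of_le_succ fun n => by
      change Ideal.span {u ^ (n + 1)} ≤ Ideal.span {u ^ n}
      rw [Ideal.span_singleton_le_iff_mem, pow_succ']
      exact Ideal.mul_mem_left _ _ (Ideal.mem_span_singleton_self _)⟩
  -- The exponent is chosen so that multiplying by u gives f ∈ Sf² for f = u ^ (k + 1).
  have hspan : Ideal.span {u ^ k} = Ideal.span {u ^ (2 * (k + 1))} := hk _ (by omega)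
  have hmem : u ^ k ∈ Ideal.span {u ^ (2 * (k + 1))} := hspan ▸ Ideal.mem_span_singleton_self _
  obtain ⟨t₀, ht₀⟩ := Ideal.mem_span_singleton_left.1 hmem
  obtain ⟨w, hw⟩ := (hu.pow (k + 1) u).2
  set f := u ^ (k + 1) with hf
  have hfn : IsNormalElem f := hu.pow _
  have hf₁ : ∃ t, f = t * (f * f) := by
    refine ⟨u * t₀, ?_⟩
    rw [hf, ← pow_add, ← two_mul, mul_assoc, ← ht₀, pow_succ']
  obtain ⟨t, ht⟩ := hf₁
  obtain ⟨t', ht'⟩ := ((hfn.mul hfn) t).2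
  rw [← ht] at ht'
  have he : t * f = f * t' := by
    calc t * f = t * (f * f * t') := by rw [← ht']
      _ = t * (f * f) * t' := by noncomm_ring
      _ = f * t' := by rw [← ht]
  have hef : t * f * f = f := by rw [mul_assoc, ← ht]
  have hfe : f * (t * f) = f := by rw [he, ← mul_assoc, ← ht']
  have hee : t * f * (t * f) = t * f := by rw [mul_assoc t f (t * f), hfe]
  refine ⟨k + 1, k.succ_pos, t * f, t, fun s => ?_, hee, rfl, hef⟩
  obtain ⟨x, hx⟩ := (hfn (t' * s)).1
  obtain ⟨z, hz⟩ := (hfn (s * t)).2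
  have h₁ : t * f * s = x * f := by rw [he, mul_assoc, hx]
  have h₂ : s * (t * f) = f * z := by rw [← mul_assoc, hz]
  -- With e = tf, both es and se equal ese: es ∈ Sf with fe = f, and se ∈ fS with ef = f.
  calc t * f * s = x * (f * (t * f)) := by rw [h₁, hfe]
    _ = t * f * s * (t * f) := by rw [h₁, mul_assoc]
    _ = t * f * (f * z) := by rw [mul_assoc (t * f), h₂]
    _ = s * (t * f) := by rw [← mul_assoc (t * f), hef, h₂]

/-- Here U + V = S and U = Su with u normal, so 1 ∈ Suⁿ + V for every n. The Fitting idempotent e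
lies in Suⁿ, and 1 - e kills uⁿ, which forces 1 - e into V. -/
theorem exists_central_idempotent_mem {S : Type*} [Ring S] [IsArtinianRing S]
    [IsPrincipalIdealRing S] [IsPrincipalIdealRing Sᵐᵒᵖ] {U V : Ideal S} [U.IsTwoSided]
    [V.IsTwoSided] {s : S} (hsU : s ∈ U) (hsV : 1 - s ∈ V) :
    ∃ e, (∀ s, e * s = s * e) ∧ e * e = e ∧ e ∈ U ∧ 1 - e ∈ V := by
  obtain ⟨u, huU, hu, hgen⟩ := exists_isNormalElem_generator U
  obtain ⟨n, hn, e, p, hcomm, hee, hep, heu⟩ := hu.exists_central_idempotent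
  have hpow : ∀ m : ℕ, ∃ q, 1 - q * u ^ m ∈ V := by
    intro m
    induction m with
    | zero => exact ⟨1, by simp⟩
    | succ m ih =>
      obtain ⟨q, hq⟩ := ih
      obtain ⟨r, rfl⟩ := hgen s hsU
      refine ⟨q * r, ?_⟩
      obtain ⟨v, hv⟩ := ((hu.pow m) (1 - r * u)).1
      have h₁ : q * (1 - r * u) * u ^ m ∈ V :=
        V.mul_mem_right _ (V.mul_mem_left _ hsV)
      have : 1 - q * r * u ^ (m + 1) = (1 - q * u ^ m) + q * (1 - r * u) * u ^ m := by
        rw [pow_succ']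
        noncomm_ring
      rw [this]
      exact V.add_mem hq h₁
  obtain ⟨q, hq⟩ := hpow n
  refine ⟨e, hcomm, hee, ?_, ?_⟩
  · rw [hep]
    exact U.mul_mem_left _ (U.pow_mem_of_mem huU n hn)
  · have : (1 - e) * (1 - q * u ^ n) = 1 - e := by
      have h₁ : (1 - e) * q * u ^ n = 0 := by
        calc (1 - e) * q * u ^ n = q * u ^ n - e * q * u ^ n := by noncomm_ring
          _ = q * u ^ n - q * (e * u ^ n) := by rw [hcomm q, mul_assoc]
          _ = 0 := by rw [heu, sub_self]
      calc (1 - e) * (1 - q * u ^ n) = (1 - e) - (1 - e) * q * u ^ n := by noncomm_ring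
        _ = 1 - e := by rw [h₁, sub_zero]
    rw [← this]
    exact V.mul_mem_left _ hq

/-! ### Left and right annihilators of a normal element -/

/-- If a surjective additive and multiplicative relation from a left noetherian ring onto itself
is the graph of a homomorphism, then this homomorphism is injective. -/
theorem Subring.mk_zero_mem_of_surjective {S : Type*} [Ring S] [IsNoetherianRing S]
    (ρ : Subring (S × S)) (h₁ : ∀ s, ∃ t, (s, t) ∈ ρ) (h₂ : ∀ t, ∃ s, (s, t) ∈ ρ)
    (h : ∀ t, (0, t) ∈ ρ → (t, 0) ∈ ρ) : ∀ s, (s, 0) ∈ ρ → (0, s) ∈ ρ := by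
  let next : Ideal S → Ideal S := fun I =>
    { carrier := {s | ∃ t ∈ I, (s, t) ∈ ρ}
      add_mem' := by
        rintro a b ⟨t, ht, hat⟩ ⟨u, hu, hbu⟩
        exact ⟨t + u, I.add_mem ht hu, ρ.add_mem hat hbu⟩
      zero_mem' := ⟨0, I.zero_mem, ρ.zero_mem⟩
      smul_mem' := by
        rintro r a ⟨t, ht, hat⟩
        obtain ⟨r', hr'⟩ := h₁ r
        exact ⟨r' * t, I.mul_mem_left _ ht, ρ.mul_mem hr' hat⟩ }
  let I₀ : Ideal S :=
    { carrier := {t | (0, t) ∈ ρ}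
      add_mem' := fun ha hb => by simpa using ρ.add_mem ha hb
      zero_mem' := ρ.zero_mem
      smul_mem' := fun r a ha => by
        obtain ⟨r', hr'⟩ := h₂ r
        simpa using ρ.mul_mem hr' ha }
  -- The iterated preimages of I₀ under the relation; I₀ measures its ambiguity, and I 1 contains
  -- all s related to 0.
  let I : ℕ → Ideal S := fun n => next^[n] I₀
  have hIsucc : ∀ n s, s ∈ I (n + 1) ↔ ∃ t ∈ I n, (s, t) ∈ ρ := fun n s => by
    change s ∈ next^[n + 1] I₀ ↔ _
    rw [Function.iterate_succ_apply']
    rfl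
  have hmono : Monotone I := by
    refine monotone_nat_of_le_succ fun n => ?_
    induction n with
    | zero => exact fun t ht => (hIsucc 0 t).2 ⟨0, (I 0).zero_mem, h t ht⟩
    | succ n ih =>
      intro s hs
      obtain ⟨t, ht, hst⟩ := (hIsucc n s).1 hs
      exact (hIsucc _ s).2 ⟨t, ih ht, hst⟩
  -- Every s is related to some t, so stabilisation at any stage descends to I 1 ≤ I 0.
  have hdesc : ∀ n, I (n + 1) ≤ I n → I 1 ≤ I 0 := by
    intro n
    induction n with
    | zero => exact id
    | succ n ih =>
      intro hle
      refine ih fun s hs => ?_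
      obtain ⟨t, hst⟩ := h₂ s
      obtain ⟨u, hu, htu⟩ := (hIsucc n t).1 (hle ((hIsucc _ t).2 ⟨s, hs, hst⟩))
      have hsu : s - u ∈ I 0 := by
        change (0, s - u) ∈ ρ
        simpa using ρ.sub_mem hst htu
      simpa using (I n).add_mem (hmono n.zero_le hsu) hu
  obtain ⟨n, hn⟩ := monotone_stabilizes_iff_noetherian.2 ‹IsNoetherianRing S› ⟨I, hmono⟩
  intro s hs
  exact hdesc n (hn (n + 1) n.le_succ).ge ((hIsucc 0 s).2 ⟨0, (I 0).zero_mem, hs⟩)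

/-- The pairs `(s, t)` with `s a = a t`. -/
def intertwiningSubring {S : Type*} [Ring S] (a : S) : Subring (S × S) where
  carrier := {x | x.1 * a = a * x.2}
  mul_mem' {x y} hx hy := by
    simp only [Set.mem_ofPred_eq, Prod.fst_mul, Prod.snd_mul] at *
    rw [mul_assoc, hy, ← mul_assoc, hx, mul_assoc]
  one_mem' := by simp
  add_mem' {x y} hx hy := by
    simp only [Set.mem_ofPred_eq, Prod.fst_add, Prod.snd_add] at *
    rw [add_mul, hx, hy, mul_add]
  zero_mem' := by simp
  neg_mem' {x} hx := by
    simp only [Set.mem_ofPred_eq, Prod.fst_neg, Prod.snd_neg] at *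
    rw [neg_mul, hx, mul_neg]

/-- The relation sa = at has full projections because a is normal; 0 is related to the right
annihilator, and the left annihilator to 0. -/
theorem IsNormalElem.mul_eq_zero_of_right_le_left {S : Type*} [Ring S] [IsNoetherianRing S] {a : S}
    (ha : IsNormalElem a) (h : ∀ s, a * s = 0 → s * a = 0) : ∀ s, s * a = 0 → a * s = 0 := by
  intro s hs
  have := (intertwiningSubring a).mk_zero_mem_of_surjective (fun s => (ha s).2)
    (fun t => (ha t).1.imp fun _ h => h.symm)
    (fun t (ht : 0 * a = a * t) => show t * a = a * 0 by
      rw [mul_zero, h t (by rw [← ht, zero_mul])]) s (show s * a = a * 0 by rw [hs, mul_zero])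
  exact (show 0 * a = a * s from this).symm.trans (zero_mul a)

theorem IsNormalElem.mul_eq_zero_of_left_le_right {S : Type*} [Ring S] [IsNoetherianRing S] {a : S}
    (ha : IsNormalElem a) (h : ∀ s, s * a = 0 → a * s = 0) : ∀ s, a * s = 0 → s * a = 0 := by
  intro s hs
  have := ((intertwiningSubring a).comap
    (RingEquiv.prodComm : S × S ≃+* S × S).toRingHom).mk_zero_mem_of_surjective
    (fun s => (ha s).1.imp fun _ h => h.symm) (fun t => (ha t).2)
    (fun t (ht : t * a = a * 0) => show 0 * a = a * t by
      rw [zero_mul, h t (by rw [ht, mul_zero])]) s (show 0 * a = a * s by rw [hs, zero_mul])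
  exact (show s * a = a * 0 from this).trans (mul_zero a)

/-- Left and right annihilators of a normal element of an artinian principal ring coincide. -/
theorem IsNormalElem.mul_eq_zero_comm {S : Type*} [Ring S] (hS : IsArtinianPrincipalRing S)
    {a : S} (ha : IsNormalElem a) (s : S) : s * a = 0 ↔ a * s = 0 := by
  obtain ⟨_, _, _, _⟩ := hS
  let K : Ideal S :=
    { carrier := {x | x * a = 0}
      add_mem' := fun {x y} (hx : x * a = 0) (hy : y * a = 0) =>
        show (x + y) * a = 0 by rw [add_mul, hx, hy, add_zero]
      zero_mem' := zero_mul a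
      smul_mem' := fun r x (hx : x * a = 0) => show r * x * a = 0 by
        rw [mul_assoc, hx, mul_zero] }
  have hK : ∀ x, x ∈ K ↔ x * a = 0 := fun _ => Iff.rfl
  have hKt : K.IsTwoSided := ⟨fun {x} r hx => by
    obtain ⟨t, ht⟩ := (ha r).2
    rw [hK] at *
    rw [mul_assoc, ht, ← mul_assoc, hx, zero_mul]⟩
  let L : Ideal S :=
    { carrier := {x | a * x = 0}
      add_mem' := fun {x y} (hx : a * x = 0) (hy : a * y = 0) =>
        show a * (x + y) = 0 by rw [mul_add, hx, hy, add_zero]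
      zero_mem' := mul_zero a
      smul_mem' := fun r x (hx : a * x = 0) => show a * (r * x) = 0 by
        obtain ⟨t, ht⟩ := (ha r).1
        rw [← mul_assoc, ht, mul_assoc, hx, mul_zero] }
  have hL : ∀ x, x ∈ L ↔ a * x = 0 := fun _ => Iff.rfl
  have hLt : L.IsTwoSided := ⟨fun {x} r hx => by
    rw [hL] at *
    rw [← mul_assoc, hx, zero_mul]⟩
  have colon : ∀ (A B : Ideal S), A.IsTwoSided → B.IsTwoSided →
      ∃ U : Ideal S, U.IsTwoSided ∧ ∀ s, s ∈ U ↔ ∀ x ∈ A, x * s ∈ B := by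
    intro A B _ _
    refine ⟨{ carrier := {s | ∀ x ∈ A, x * s ∈ B}
              add_mem' := fun {s t} hs ht x hx => ?_
              zero_mem' := fun x _ => by simp
              smul_mem' := fun r s hs x hx => ?_ }, ⟨fun {s} r hs x hx => ?_⟩, fun _ => Iff.rfl⟩
    · rw [mul_add]
      exact B.add_mem (hs x hx) (ht x hx)
    · rw [smul_eq_mul, ← mul_assoc]
      exact hs _ (A.mul_mem_right r hx)
    · rw [← mul_assoc]
      exact B.mul_mem_right _ (hs x hx)
  -- U = {s | Ks ⊆ L} and V = {s | Ls ⊆ K} are comaximal. A central idempotent e ∈ U with 1 - e ∈ V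
  -- gives ae and a(1 - e) opposite annihilator inclusions.
  obtain ⟨U, _, hU⟩ := colon K L inferInstance inferInstance
  obtain ⟨V, _, hV⟩ := colon L K inferInstance inferInstance
  obtain ⟨s₀, hs₁, hs₂⟩ := exists_mul_mem_and_mul_one_sub_mem L K
  obtain ⟨e, hcomm, hee, heU, heV⟩ :=
    exists_central_idempotent_mem ((hU s₀).2 hs₁) ((hV (1 - s₀)).2 hs₂)
  rw [hU] at heU
  rw [hV] at heV
  have hcomm' : ∀ x, (1 - e) * x = x * (1 - e) := fun x => by
    rw [sub_mul, mul_sub, hcomm, one_mul, mul_one]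
  have hn₁ : IsNormalElem (a * e) := ha.mul (isNormalElem_of_commute hcomm)
  have hn₂ : IsNormalElem (a * (1 - e)) := ha.mul (isNormalElem_of_commute hcomm')
  have sw₁ : ∀ x, x * (a * e) = x * e * a := fun x => by rw [← hcomm, mul_assoc]
  have sw₁' : ∀ x, a * e * x = a * (x * e) := fun x => by rw [mul_assoc, hcomm]
  have sw₂ : ∀ x, x * (a * (1 - e)) = x * (1 - e) * a := fun x => by rw [← hcomm', mul_assoc]
  have sw₂' : ∀ x, a * (1 - e) * x = a * (x * (1 - e)) := fun x => by rw [mul_assoc, hcomm']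
  have hee' : (1 - e) * (1 - e) = 1 - e := by
    calc (1 - e) * (1 - e) = 1 - e - e + e * e := by noncomm_ring
      _ = 1 - e := by rw [hee]; abel
  have h₁ : ∀ x, x * (a * e) = 0 → a * e * x = 0 := fun x hx => by
    rw [sw₁] at hx
    have := heU _ ((hK _).2 hx)
    rwa [mul_assoc, hee, hL, ← sw₁'] at this
  have h₂ : ∀ x, a * (1 - e) * x = 0 → x * (a * (1 - e)) = 0 := fun x hx => by
    rw [sw₂'] at hx
    have := heV _ ((hL _).2 hx)
    rwa [mul_assoc, hee', hK, ← sw₂] at this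
  have h₁' := hn₁.mul_eq_zero_of_left_le_right h₁
  have h₂' := hn₂.mul_eq_zero_of_right_le_left h₂
  have dec : a = a * e + a * (1 - e) := by noncomm_ring
  constructor
  · intro hs
    rw [dec, add_mul, h₁ s, h₂' s, add_zero]
    · rw [← mul_assoc, hs, zero_mul]
    · rw [← mul_assoc, hs, zero_mul]
  · intro hs
    rw [dec, mul_add, h₁' s, h₂ s, add_zero]
    · rw [sw₂', ← mul_assoc, hs, zero_mul]
    · rw [sw₁', ← mul_assoc, hs, zero_mul]

/-! ### The trivial extension -/

namespace TrivSqZeroExt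

variable {R M : Type*} [Ring R] [AddCommGroup M] [Module R M] [Module Rᵐᵒᵖ M]

variable (R M) in
/-- The projection of a trivial square-zero extension onto its base ring. -/
def fstRingHom : TrivSqZeroExt R M →+* R where
  toFun := fst
  map_one' := rfl
  map_mul' _ _ := rfl
  map_zero' := rfl
  map_add' _ _ := rfl

@[simp]
theorem fstRingHom_apply (x : TrivSqZeroExt R M) : fstRingHom R M x = x.fst := rfl

theorem fstRingHom_surjective : Function.Surjective (fstRingHom R M) := fun r => ⟨inl r, rfl⟩

theorem mul_eq_zero_of_fst_eq_zero {x y : TrivSqZeroExt R M} (hx : x.fst = 0) (hy : y.fst = 0) :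
    x * y = 0 := by
  ext <;> simp [hx, hy]

variable [SMulCommClass R Rᵐᵒᵖ M]

theorem isLeftTNilpotent_preimage_fst {X : Set R} (hX : IsLeftTNilpotent X) :
    IsLeftTNilpotent (fst ⁻¹' X : Set (TrivSqZeroExt R M)) := by
  intro a ha
  obtain ⟨n, hn, hn0⟩ := hX (fun i => (a i).fst) ha
  -- Two consecutive blocks each have product in 0 ⊕ M, which squares to zero.
  obtain ⟨k, -, hk0⟩ := hX (fun i => (a (n + i)).fst) fun i => ha _
  refine ⟨n + k, by omega, ?_⟩
  rw [initialProd_add]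
  refine mul_eq_zero_of_fst_eq_zero ?_ ?_
  · rw [← fstRingHom_apply, map_initialProd]
    exact hn0
  · rw [← fstRingHom_apply, map_initialProd]
    exact hk0

theorem jacobson_eq_comap (hR : IsLeftTNilpotent (Ring.jacobson R : Set R)) :
    Ring.jacobson (TrivSqZeroExt R M) = Ideal.comap (fstRingHom R M) (Ring.jacobson R) := by
  have : RingHomSurjective (fstRingHom R M) := ⟨fstRingHom_surjective⟩
  refine le_antisymm (Ring.le_comap_jacobson _) fun x hx => ?_
  rw [← Ideal.jacobson_bot, Ideal.mem_jacobson_iff]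
  intro y
  have hyx : y * x ∈ Ideal.comap (fstRingHom R M) (Ring.jacobson R) := Ideal.mul_mem_left _ _ hx
  obtain ⟨n, -, hn⟩ := isLeftTNilpotent_preimage_fst (M := M) hR (fun _ => y * x) fun _ => hyx
  rw [initialProd_const] at hn
  obtain ⟨u, hu⟩ := IsNilpotent.isUnit_add_one ⟨n, hn⟩
  refine ⟨↑u⁻¹, ?_⟩
  have : (↑u⁻¹ : TrivSqZeroExt R M) * y * x + ↑u⁻¹ = ↑u⁻¹ * ↑u := by
    rw [hu, mul_add, mul_one, mul_assoc]
  rw [this, Units.inv_mul, sub_self]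
  exact zero_mem _

theorem isLeftPerfectRing (hR : IsLeftPerfectRing R) : IsLeftPerfectRing (TrivSqZeroExt R M) := by
  have hJ := jacobson_eq_comap (M := M) hR.tNilpotent
  constructor
  · have := hR.semisimple
    let f := (Ideal.Quotient.mk (Ring.jacobson R)).comp (fstRingHom R M)
    have hf : Function.Surjective f := Ideal.Quotient.mk_surjective.comp fstRingHom_surjective
    have hker : RingHom.ker f = Ring.jacobson (TrivSqZeroExt R M) := by
      rw [hJ, ← RingHom.comap_ker, Ideal.mk_ker]
    exact ((Ideal.quotEquivOfEq hker).symm.trans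
      (RingHom.quotientKerEquivOfSurjective hf)).symm.isSemisimpleRing
  · rw [hJ]
    exact isLeftTNilpotent_preimage_fst hR.tNilpotent

/-- The kernel 0 ⊕ M of the projection has a normal generator (0, m); its annihilators are compared
on elements (r, 0). -/
theorem exists_bimodule_generator (hS : IsArtinianPrincipalRing (TrivSqZeroExt R M)) :
    ∃ m : M, (∀ x : M, ∃ r : R, x = r • m) ∧ (∀ x : M, ∃ r : R, x = MulOpposite.op r • m) ∧
      ∀ r : R, r • m = 0 ↔ MulOpposite.op r • m = 0 := by
  have := hS.left_principal
  have := hS.right_principal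
  obtain ⟨a, haA, ha, hgen⟩ := exists_isNormalElem_generator (RingHom.ker (fstRingHom R M))
  obtain ⟨m, rfl⟩ : ∃ m, a = inr m := ⟨a.snd, ext haA rfl⟩
  have hleft : ∀ x : M, ∃ s, inr x = s * inr m := fun x => hgen (inr x) rfl
  refine ⟨m, fun x => ?_, fun x => ?_, fun r => ?_⟩
  · obtain ⟨s, hs⟩ := hleft x
    exact ⟨s.fst, by simpa using congrArg snd hs⟩
  · obtain ⟨s, hs⟩ := hleft x
    obtain ⟨t, ht⟩ := (ha s).2
    exact ⟨t.fst, by simpa using congrArg snd (hs.trans ht)⟩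
  · have h := ha.mul_eq_zero_comm hS (inl r)
    rwa [inl_mul_inr, inr_mul_inl, ← inr_zero, inr_injective.eq_iff, inr_injective.eq_iff] at h

end TrivSqZeroExt

/-! ### The twisting automorphism -/

/-- A bimodule generated on both sides by the same element, with the same left and right
annihilator, is a quotient ring with right multiplication twisted by an automorphism. -/
theorem exists_bimoduleEquiv_twisted {R M : Type*} [Ring R] [AddCommGroup M] [Module R M]
    [Module Rᵐᵒᵖ M] [SMulCommClass R Rᵐᵒᵖ M] (m : M) (hl : ∀ x : M, ∃ r : R, x = r • m)
    (hr : ∀ x : M, ∃ r : R, x = MulOpposite.op r • m)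
    (hlr : ∀ r : R, r • m = 0 ↔ MulOpposite.op r • m = 0) :
    ∃ (I : Ideal R) (_ : I.IsTwoSided) (σ : (R ⧸ I) ≃+* (R ⧸ I)),
      Nonempty (BimoduleEquiv R M
        (RestrictBimodule (Ideal.Quotient.mk I) (TwistedBimodule (σ : (R ⧸ I) →+* (R ⧸ I))))) := by
  let φ := LinearMap.toSpanSingleton R M m
  let I : Ideal R := LinearMap.ker φ
  have hI : ∀ r, r ∈ I ↔ r • m = 0 := fun _ => LinearMap.mem_ker
  have hIt : I.IsTwoSided := ⟨fun {a} b ha => by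
    rw [hI] at *
    obtain ⟨t, ht⟩ := hr (b • m)
    rw [mul_smul, ht, smul_comm, ha, smul_zero]⟩
  have hmk : ∀ r s : R, Ideal.Quotient.mk I r = Ideal.Quotient.mk I s ↔ r • m = s • m :=
    fun r s => by rw [Ideal.Quotient.eq, hI, sub_smul, sub_eq_zero]
  -- The choice of τ(t) with mt = τ(t)m is unique modulo I, hence multiplicative there.
  choose τ hτ using fun t : R => hl (MulOpposite.op t • m)
  let f : R →+* R ⧸ I :=
    { toFun := fun t => Ideal.Quotient.mk I (τ t)
      map_one' := by
        rw [← map_one (Ideal.Quotient.mk I), hmk, ← hτ, MulOpposite.op_one, one_smul, one_smul]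
      map_mul' := fun s t => by
        rw [← map_mul, hmk, ← hτ, MulOpposite.op_mul, mul_smul, hτ s, ← smul_comm, hτ t, mul_smul]
      map_zero' := by
        rw [← map_zero (Ideal.Quotient.mk I), hmk, ← hτ, MulOpposite.op_zero, zero_smul, zero_smul]
      map_add' := fun s t => by
        rw [← map_add, hmk, ← hτ, MulOpposite.op_add, add_smul, hτ s, hτ t, add_smul] }
  have hf : ∀ s t, f t = Ideal.Quotient.mk I s ↔ MulOpposite.op t • m = s • m := fun s t => by
    rw [hτ, ← hmk]
    rfl
  have hsurj : Function.Surjective f := fun x => by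
    obtain ⟨s, rfl⟩ := Ideal.Quotient.mk_surjective x
    obtain ⟨t, ht⟩ := hr (s • m)
    exact ⟨t, (hf s t).2 ht.symm⟩
  -- The kernel is the right annihilator of m; its equality with the left one makes σ injective on
  -- R/I.
  have hker : RingHom.ker f = I := Ideal.ext fun t => by
    rw [RingHom.mem_ker, ← map_zero (Ideal.Quotient.mk I), hf, zero_smul, hI, hlr]
  let σ : (R ⧸ I) ≃+* (R ⧸ I) :=
    (Ideal.quotEquivOfEq hker).symm.trans (RingHom.quotientKerEquivOfSurjective hsurj)
  have hσ : ∀ t, σ (Ideal.Quotient.mk I t) = Ideal.Quotient.mk I (τ t) := fun t => rfl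
  let e : (R ⧸ I) ≃ₗ[R] M := φ.quotKerEquivOfSurjective fun x => (hl x).imp fun _ h => h.symm
  have he : ∀ r : R, e (Ideal.Quotient.mk I r) = r • m := fun r => rfl
  have hes : ∀ r : R, e.symm (r • m) = Ideal.Quotient.mk I r := fun r => by
    rw [← he, e.symm_apply_apply]
  refine ⟨I, hIt, σ, ⟨{ e.symm.toAddEquiv with map_smul' := fun r x => ?_
                                               map_op_smul' := fun r x => ?_ }⟩⟩
  · obtain ⟨s, rfl⟩ := hl x
    change e.symm (r • s • m) = Ideal.Quotient.mk I r * e.symm (s • m)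
    rw [← mul_smul, hes, hes, map_mul]
  · obtain ⟨s, rfl⟩ := hl x
    change e.symm (MulOpposite.op r • s • m) = e.symm (s • m) * σ (Ideal.Quotient.mk I r)
    rw [hσ, ← smul_comm, hτ, ← mul_smul, hes, hes, map_mul]

theorem mainTheorem2 {R : Type*} [Ring R] {M : Type*} [AddCommGroup M]
    [Module R M] [Module Rᵐᵒᵖ M] [SMulCommClass R Rᵐᵒᵖ M]
    (hR : IsLeftPerfectRing R) (hS : IsQuasiMorphicRing (TrivSqZeroExt R M)) :
    IsArtinianPrincipalRing R ∧
    IsArtinianPrincipalRing (TrivSqZeroExt R M) ∧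
    ∃ (I : Ideal R) (_ : I.IsTwoSided) (σ : (R ⧸ I) ≃+* (R ⧸ I)),
      Nonempty (BimoduleEquiv R M
        (RestrictBimodule (Ideal.Quotient.mk I) (TwistedBimodule (σ : (R ⧸ I) →+* (R ⧸ I))))) := by
  have h := (TrivSqZeroExt.isLeftPerfectRing (M := M) hR).isArtinianPrincipalRing hS
  obtain ⟨m, hl, hr, hlr⟩ := TrivSqZeroExt.exists_bimodule_generator h
  exact ⟨h.of_surjective _ TrivSqZeroExt.fstRingHom_surjective, h,
    exists_bimoduleEquiv_twisted m hl hr hlr⟩
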